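/- Let $N=\{1,\dots,n\}$. All matrices below have entries in a field $\mathbb F$, where $\mathbb F$ is either $\mathbb R$ or $\mathbb C$ (every claim holds for both); positive definite (PD) matrices are symmetric, respectively Hermitian. A ratio $R=\alpha/\beta$ assigns to a matrix $A$ the value $R(A)=\prod_{S\subseteq N}(\det A[S])^{a_S}\big/\prod_{S\subseteq N}(\det A[S])^{b_S}$ with real exponents $a_S,b_S\ge 0$, where $A[S]$ is the principal submatrix on $S$ and $\det A[\emptyset]=1$. Its formal logarithm $\log R\in\mathbb R^{2^N}$ has entry $a_S-b_S$ for $S\ne\emptyset$, and the entry at $\emptyset$ is chosen so that all entries sum to $0$. $R$ is homogeneous if $R(D)=1$ for all PD diagonal $D$; it is self-complementary if $\log R$ is invariant under $S\mapsto N\setminus S$. $\mathcal B_n$ is the set of ratios that are bounded above over all $n\times n$ PD matrices. For a matrix $M$ with $n$ columns, $\operatorname{nul}(M)\in\mathbb R^{2^N}$ is the vector of null space dimensions of the subsets of the columns of $M$, and $\mathcal D_n$ is the set of homogeneous ratios $R$ with $\log(R)^T\operatorname{nul}(M)\ge 0$ for every matrix $M$ with $n$ columns. $\mathcal K_n$ is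 the set of ratios whose formal logarithm is that of a product of positive powers of Koteljanskii ratios $\frac{(S\cup T)(S\cap T)}{S\;T}$. Two vectors are called parallel if they are linearly dependent. Let $n=5$, $$Q=\frac{\{12345\}\{1345\}\{2345\}\{123\}\{125\}\{34\}\{45\}\{1\}\{2\}\,\emptyset}{\{1234\}\{1235\}\{145\}\{245\}\{345\}\{12\}\{13\}\{23\}\{4\}\{5\}},\qquad P(\varepsilon)=\begin{bmatrix}1&1&1&1&1\\0&\varepsilon&0&1&2\\0&0&\varepsilon&1&2\\0&0&0&\varepsilon&0\\0&0&0&0&\varepsilon\end{bmatrix},$$ where an index set $S$ in $Q$ stands for $\det A[S]$, and let $A_\varepsilon=P(\varepsilon)^*P(\varepsilon)$ for real $\varepsilon$. Then: 1. $Q$ is self-complementary, and for each $i\in N$ the ratio obtained from $Q$ by deleting $i$ from all index sets lies in $\mathcal K_5$. 2. $Q\in\mathcal D_5$. 3. Exactly $37$ partitions of $\{1,\dots,5\}$ have a number of blocks different from $2$. Every partition of $\{1,\dots,5\}$ is the partition into parallel classes of the columns of some $2\times5$ matrix without zero column, and $\operatorname{nul}(M)$ is the same for all such matrices $M$ with the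 same partition. If $R$ is a homogeneous self-complementary ratio on $5$ indices such that deleting any one index from all of its index sets gives a ratio in $\mathcal K_5$, then $R\in\mathcal D_5$ if and only if $\log(R)^T\operatorname{nul}(M)\ge0$ for every $2\times 5$ matrix $M$ without zero column whose columns do not form exactly two parallel classes; that is, only these $37$ cases have to be checked. 4. There is exactly one vector $\operatorname{asn}(P)=[d_S]_{S\subseteq N}$ of nonnegative integers such that for every $S\subseteq N$ there is $C_S>0$ with $\det A_\varepsilon[S]\sim C_S\,\varepsilon^{2d_S}$ as $\varepsilon\to0$ (the asymptotic nullity type of $P$), and $\log(Q)^T\operatorname{asn}(P)=-1$. 5. $A_\varepsilon$ is PD for every $\varepsilon>0$, and $Q(A_\varepsilon)\to+\infty$ as $\varepsilon\to0^+$; in particular $Q$ is unbounded along $A_\varepsilon$ and $Q\notin\mathcal B_5$. Hence $\mathcal B_5\ne\mathcal D_5$, and also $\log(\mathcal B_5)\ne\log(\mathcal D_5)$. -/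

import Mathlib

open scoped ComplexOrder NNReal Polynomial

/-- A formal ratio `α / β` of products of principal minors of `n × n` matrices: `num S` (`den S`)
is the exponent of `det A[S]` in `α` (in `β`), and exponent `0` means that `S` does not occur. -/
@[ext]
structure MinorRatio (n : ℕ) where
  num : Finset (Fin n) → ℝ≥0
  den : Finset (Fin n) → ℝ≥0

/-- The vector of null space dimensions of the subsets of the columns of `M`. -/
noncomputable def nullityType {𝕜 : Type*} [RCLike 𝕜] {m n : ℕ} (M : Matrix (Fin m) (Fin n) 𝕜)
    (S : Finset (Fin n)) : ℕ :=
  Module.finrank 𝕜 (LinearMap.ker (M.submatrix id (fun i : S => (i : Fin n))).mulVecLin)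

/-- The principal minor `det A[S]`, as a real number (for Hermitian `A` it is real); the minor of
the empty index set is `1`. -/
noncomputable def principalMinor {𝕜 : Type*} [RCLike 𝕜] {n : ℕ} (A : Matrix (Fin n) (Fin n) 𝕜)
    (S : Finset (Fin n)) : ℝ :=
  RCLike.re (A.submatrix (fun i : S => (i : Fin n)) (fun i : S => (i : Fin n))).det

namespace MinorRatio

/-- The value `α(A) / β(A)`. -/
noncomputable def value {𝕜 : Type*} [RCLike 𝕜] {n : ℕ} (R : MinorRatio n)
    (A : Matrix (Fin n) (Fin n) 𝕜) : ℝ :=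
  (∏ S, principalMinor A S ^ (R.num S : ℝ)) / ∏ S, principalMinor A S ^ (R.den S : ℝ)

/-- The formal logarithm: overall exponents of the nonempty index sets, the exponent of `∅` being
chosen so that all exponents sum to `0`. -/
noncomputable def log {n : ℕ} (R : MinorRatio n) (S : Finset (Fin n)) : ℝ :=
  if S = ∅ then -∑ T ∈ Finset.univ.erase (∅ : Finset (Fin n)), ((R.num T : ℝ) - R.den T)
  else (R.num S : ℝ) - R.den S

/-- The inner product of the formal logarithm with a vector of natural numbers indexed by
subsets. -/
noncomputable def logInner {n : ℕ} (R : MinorRatio n) (v : Finset (Fin n) → ℕ) : ℝ :=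
  ∑ S, R.log S * (v S : ℝ)

/-- The ratio has value `1` at every positive definite diagonal matrix. -/
def IsHomogeneous (𝕜 : Type*) [RCLike 𝕜] {n : ℕ} (R : MinorRatio n) : Prop :=
  ∀ d : Fin n → 𝕜, (Matrix.diagonal d).PosDef → R.value (Matrix.diagonal d) = 1

/-- The formal logarithm is invariant under complementation of index sets. -/
def IsSelfComplementary {n : ℕ} (R : MinorRatio n) : Prop :=
  ∀ S, R.log Sᶜ = R.log S

/-- Delete the index `i` from all index sets of the ratio. -/
noncomputable def deleteIndex {n : ℕ} (i : Fin n) (R : MinorRatio n) : MinorRatio n where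
  num T := ∑ S with S.erase i = T, R.num S
  den T := ∑ S with S.erase i = T, R.den S

/-- The ratio `det A[S ∪ T] det A[S ∩ T] / (det A[S] det A[T])`. -/
noncomputable def koteljanskii {n : ℕ} (S T : Finset (Fin n)) : MinorRatio n where
  num := Pi.single (S ∪ T) 1 + Pi.single (S ∩ T) 1
  den := Pi.single S 1 + Pi.single T 1

end MinorRatio

/-- The semigroup `𝓑ₙ` of ratios bounded over all positive definite matrices. -/
def boundedRatios (𝕜 : Type*) [RCLike 𝕜] (n : ℕ) : Set (MinorRatio n) :=
  {R | ∃ C : ℝ, ∀ A : Matrix (Fin n) (Fin n) 𝕜, A.PosDef → R.value A ≤ C}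

/-- The dual nullity semigroup `𝓓ₙ`. -/
def dualNullity (𝕜 : Type*) [RCLike 𝕜] (n : ℕ) : Set (MinorRatio n) :=
  {R | R.IsHomogeneous 𝕜 ∧
    ∀ (m : ℕ) (M : Matrix (Fin m) (Fin n) 𝕜), 0 ≤ R.logInner (nullityType M)}

/-- The semigroup `𝓚ₙ` of ratios that are, up to equality of formal logarithms, products of
positive powers of Koteljanskii ratios. -/
def koteljanskiiProducts (n : ℕ) : Set (MinorRatio n) :=
  {R | R.log ∈ Submodule.span ℝ≥0
    (Set.range fun p : Finset (Fin n) × Finset (Fin n) => (MinorRatio.koteljanskii p.1 p.2).log)}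

/-- The `2 × n` matrix `M` has no zero column, and `r` is the partition of its columns into classes
of parallel (linearly dependent) columns. -/
def HasParallelClasses {𝕜 : Type*} [RCLike 𝕜] {n : ℕ} (M : Matrix (Fin 2) (Fin n) 𝕜)
    (r : Setoid (Fin n)) : Prop :=
  (∀ i, M.col i ≠ 0) ∧ ∀ i j, r i j ↔ ¬ LinearIndependent 𝕜 ![M.col i, M.col j]

/-- The matrix `A_ε = P(ε)* P(ε)` at a real parameter `ε`, for a polynomial matrix `P`. -/
noncomputable def gramFamily {𝕜 : Type*} [RCLike 𝕜] {n : ℕ} (P : Matrix (Fin n) (Fin n) 𝕜[X])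
    (ε : ℝ) : Matrix (Fin n) (Fin n) 𝕜 :=
  (P.map (Polynomial.eval (ε : 𝕜))).conjTranspose * P.map (Polynomial.eval (ε : 𝕜))

/-- `d` is the asymptotic nullity type of `P`: for every `S` the dominating term of `det A_ε[S]`
as `ε → 0` is `C ε ^ (2 d_S)` with `C > 0`. -/
def IsAsymptoticNullityType {𝕜 : Type*} [RCLike 𝕜] {n : ℕ} (P : Matrix (Fin n) (Fin n) 𝕜[X])
    (d : Finset (Fin n) → ℕ) : Prop :=
  ∀ S, ∃ C : ℝ, 0 < C ∧
    Asymptotics.IsEquivalent (nhdsWithin (0 : ℝ) {0}ᶜ)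
      (fun ε : ℝ => principalMinor (gramFamily P ε) S) (fun ε : ℝ => C * ε ^ (2 * d S))

/-- The ratio `Q`; the index `i ∈ {1, …, 5}` is written as `i - 1 : Fin 5`. -/
noncomputable def ratioQ : MinorRatio 5 where
  num S := if S ∈ ({{0, 1, 2, 3, 4}, {0, 2, 3, 4}, {1, 2, 3, 4}, {0, 1, 2}, {0, 1, 4}, {2, 3},
    {3, 4}, {0}, {1}, ∅} : Finset (Finset (Fin 5))) then 1 else 0
  den S := if S ∈ ({{0, 1, 2, 3}, {0, 1, 2, 4}, {0, 3, 4}, {1, 3, 4}, {2, 3, 4}, {0, 1}, {0, 2},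
    {1, 2}, {3}, {4}} : Finset (Finset (Fin 5))) then 1 else 0

/-- The polynomial matrix `P`, with the variable `X` in the role of `ε`. -/
noncomputable def matrixP (𝕜 : Type*) [RCLike 𝕜] : Matrix (Fin 5) (Fin 5) 𝕜[X] :=
  !![1, 1, 1, 1, 1;
     0, Polynomial.X, 0, 1, 2;
     0, 0, Polynomial.X, 1, 2;
     0, 0, 0, Polynomial.X, 0;
     0, 0, 0, 0, Polynomial.X]

/-! ### Formal logarithms, index deletion and Koteljanskii products -/

namespace MinorRatio

variable {n : ℕ}

/-! Nullity is cardinality minus rank, and cardinality pairs to `0` with the logarithm of a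
homogeneous ratio. So a homogeneous ratio lies in `dualNullity` exactly when its logarithm pairs
nonpositively with all column rank functions. These are submodular, and a product of Koteljanskii
ratios pairs nonpositively with every submodular function.

A function that ignores an index `i` pairs with `R` as it does with the deletion of `i` from `R`. If
all deletions are Koteljanskii products, this settles matrices with a zero column. It also settles
two parallel classes, where rank is a sum of two submodular functions, each ignoring some index.
Replacing a null space by its orthogonal complement complements index sets, so for
self-complementary ratios with `n ≤ 5` two rows suffice (`exists_two_rows_logInner_eq`). Ranks then
depend only on the parallel classes, and for `Q` a finite check remains.

For unboundedness, `log Q(A_ε)` is `2 ⟨log Q, asn P⟩ log ε + O(1)`. The nullity type of `P(0)` alone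
pairs to `0` with `log Q`; the asymptotic type exceeds it by one exactly on `{0,1,2,3}`, `{0,1,2,4}`
and the full set, where the entries `-1, -1, 1` of `log Q` give the total `-1`. The pairing sees
only logarithms, so the logarithmic images differ too. -/

theorem log_of_ne_empty (R : MinorRatio n) {S : Finset (Fin n)} (hS : S ≠ ∅) :
    R.log S = (R.num S : ℝ) - R.den S := by
  simp [log, hS]

theorem sum_log (R : MinorRatio n) : ∑ S, R.log S = 0 := by
  rw [← Finset.add_sum_erase _ _ (Finset.mem_univ (∅ : Finset (Fin n)))]
  have : ∑ S ∈ Finset.univ.erase (∅ : Finset (Fin n)), R.log S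
      = ∑ S ∈ Finset.univ.erase (∅ : Finset (Fin n)), ((R.num S : ℝ) - R.den S) :=
    Finset.sum_congr rfl fun S hS => R.log_of_ne_empty (Finset.ne_of_mem_erase hS)
  rw [this]
  simp [log]

/-- The zero-sum normalisation determines the entry at `∅`, so only nonempty sets need comparing. -/
theorem log_eq_of_sum_eq_zero (R : MinorRatio n) {v : Finset (Fin n) → ℝ} (hv : ∑ S, v S = 0)
    (h : ∀ S, S ≠ ∅ → v S = (R.num S : ℝ) - R.den S) : R.log = v := by
  funext S
  by_cases hS : S = ∅
  · subst hS
    rw [← Finset.add_sum_erase _ _ (Finset.mem_univ (∅ : Finset (Fin n)))] at hv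
    have : ∑ S ∈ Finset.univ.erase (∅ : Finset (Fin n)), v S
        = ∑ S ∈ Finset.univ.erase (∅ : Finset (Fin n)), ((R.num S : ℝ) - R.den S) :=
      Finset.sum_congr rfl fun S hS => h S (Finset.ne_of_mem_erase hS)
    rw [this] at hv
    simp only [log, if_true]
    linarith
  · rw [log_of_ne_empty _ hS, h S hS]

theorem log_deleteIndex (i : Fin n) (R : MinorRatio n) :
    (R.deleteIndex i).log = fun T => ∑ S with S.erase i = T, R.log S := by
  apply log_eq_of_sum_eq_zero
  · rw [Finset.sum_fiberwise, sum_log]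
  · intro T hT
    simp only [deleteIndex, NNReal.coe_sum, ← Finset.sum_sub_distrib]
    refine Finset.sum_congr rfl fun S hS => R.log_of_ne_empty ?_
    rintro rfl
    simp only [Finset.mem_filter, Finset.erase_empty] at hS
    exact hT hS.2.symm

/-- Deletion is push-forward along `S ↦ S.erase i`, hence adjoint to pulling `f` back. -/
theorem sum_log_deleteIndex_mul (i : Fin n) (R : MinorRatio n) (f : Finset (Fin n) → ℝ) :
    ∑ T, (R.deleteIndex i).log T * f T = ∑ S, R.log S * f (S.erase i) := by
  rw [log_deleteIndex, ← Finset.sum_fiberwise (s := Finset.univ) (g := fun S => S.erase i)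
    (f := fun S => R.log S * f (S.erase i))]
  refine Finset.sum_congr rfl fun T _ => ?_
  rw [Finset.sum_mul]
  refine Finset.sum_congr rfl fun S hS => ?_
  rw [(Finset.mem_filter.1 hS).2]

/-- The formal logarithm of a Koteljanskii ratio, with integer values. -/
def koteljanskiiLog (S T U : Finset (Fin n)) : ℤ :=
  (if U = S ∪ T then 1 else 0) + (if U = S ∩ T then 1 else 0) - (if U = S then 1 else 0)
    - (if U = T then 1 else 0)

theorem log_koteljanskii (S T : Finset (Fin n)) :
    (koteljanskii S T).log = fun U => (koteljanskiiLog S T U : ℝ) := by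
  apply log_eq_of_sum_eq_zero
  · simp [koteljanskiiLog, Finset.sum_add_distrib, Finset.sum_sub_distrib]
  · intro U _
    simp only [koteljanskiiLog, koteljanskii, Pi.add_apply, Pi.single_apply]
    push_cast
    simp only [apply_ite NNReal.toReal, NNReal.coe_one, NNReal.coe_zero]
    ring

theorem sum_log_koteljanskii_mul (S T : Finset (Fin n)) (f : Finset (Fin n) → ℝ) :
    ∑ U, (koteljanskii S T).log U * f U = f (S ∪ T) + f (S ∩ T) - f S - f T := by
  simp [log_koteljanskii, koteljanskiiLog, add_mul, sub_mul, Finset.sum_add_distrib,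
    Finset.sum_sub_distrib]

/-- For one Koteljanskii ratio this is submodularity of `f`; the inequality passes to the convex
cone they generate. -/
theorem sum_log_mul_nonpos_of_mem_koteljanskiiProducts {R : MinorRatio n}
    (hR : R ∈ koteljanskiiProducts n) {f : Finset (Fin n) → ℝ}
    (hf : ∀ S T, f (S ∪ T) + f (S ∩ T) ≤ f S + f T) : ∑ S, R.log S * f S ≤ 0 := by
  have key : ∀ v ∈ Submodule.span ℝ≥0 (Set.range fun p : Finset (Fin n) × Finset (Fin n) =>
      (koteljanskii p.1 p.2).log), ∑ S, v S * f S ≤ 0 := by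
    intro v hv
    induction hv using Submodule.span_induction with
    | mem x hx =>
      obtain ⟨p, rfl⟩ := hx
      simp only [sum_log_koteljanskii_mul]
      linarith [hf p.1 p.2]
    | zero => simp
    | add x y _ _ hx hy =>
      simp only [Pi.add_apply, add_mul, Finset.sum_add_distrib]
      linarith
    | smul a x _ hx =>
      have : ∑ S, (a • x) S * f S = (a : ℝ) * ∑ S, x S * f S := by
        rw [Finset.mul_sum]
        refine Finset.sum_congr rfl fun S _ => ?_
        rw [Pi.smul_apply, NNReal.smul_def, smul_eq_mul, mul_assoc]
      rw [this]
      exact mul_nonpos_of_nonneg_of_nonpos a.2 hx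
  exact key _ hR

theorem sum_log_mul_nonpos_of_erase_eq {R : MinorRatio n} {i : Fin n}
    (hR : R.deleteIndex i ∈ koteljanskiiProducts n) {f : Finset (Fin n) → ℝ}
    (hf : ∀ S T, f (S ∪ T) + f (S ∩ T) ≤ f S + f T) (hi : ∀ S, f (S.erase i) = f S) :
    ∑ S, R.log S * f S ≤ 0 := by
  have := sum_log_mul_nonpos_of_mem_koteljanskiiProducts hR hf
  simpa only [sum_log_deleteIndex_mul, hi] using this

/-- An integer certificate for membership, suitable for checking by `decide`. -/
theorem mem_koteljanskiiProducts_of_list {R : MinorRatio n}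
    (l : List (Finset (Fin n) × Finset (Fin n)))
    (h : ∀ U, R.log U = ((l.map fun p => koteljanskiiLog p.1 p.2 U).sum : ℤ)) :
    R ∈ koteljanskiiProducts n := by
  have h' : R.log = (l.map fun p => (koteljanskii p.1 p.2).log).sum := by
    funext U
    rw [h U]
    clear h
    induction l with
    | nil => simp
    | cons p l ih =>
      simp only [List.map_cons, List.sum_cons, Int.cast_add, Pi.add_apply, ih, log_koteljanskii]
  rw [koteljanskiiProducts, Set.mem_ofPred_eq, h']
  apply list_sum_mem
  intro x hx
  obtain ⟨p, -, rfl⟩ := List.mem_map.1 hx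
  exact Submodule.subset_span ⟨p, rfl⟩

end MinorRatio

/-! ### Values at positive definite matrices and homogeneity -/

section Values

variable {𝕜 : Type*} [RCLike 𝕜] {n : ℕ}

theorem principalMinor_empty (A : Matrix (Fin n) (Fin n) 𝕜) : principalMinor A ∅ = 1 := by
  simp [principalMinor]

theorem Matrix.PosDef.principalMinor_pos {A : Matrix (Fin n) (Fin n) 𝕜} (hA : A.PosDef)
    (S : Finset (Fin n)) : 0 < principalMinor A S :=
  (RCLike.pos_iff.1 (hA.submatrix (e := fun i : S => (i : Fin n))
    Subtype.val_injective).det_pos).1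

theorem MinorRatio.value_eq_exp (R : MinorRatio n) {A : Matrix (Fin n) (Fin n) 𝕜}
    (hA : ∀ S, 0 < principalMinor A S) :
    R.value A = Real.exp (∑ S, R.log S * Real.log (principalMinor A S)) := by
  have h (e : Finset (Fin n) → ℝ≥0) : ∏ S, principalMinor A S ^ (e S : ℝ)
      = Real.exp (∑ S, (e S : ℝ) * Real.log (principalMinor A S)) := by
    rw [Real.exp_sum]
    refine Finset.prod_congr rfl fun S _ => ?_
    rw [Real.rpow_def_of_pos (hA S), mul_comm]
  rw [value, h, h, ← Real.exp_sub, ← Finset.sum_sub_distrib]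
  congr 1
  refine Finset.sum_congr rfl fun S _ => ?_
  by_cases hS : S = ∅
  · simp [hS, principalMinor_empty]
  · rw [R.log_of_ne_empty hS, sub_mul]

theorem principalMinor_diagonal_ofReal (d : Fin n → ℝ) (S : Finset (Fin n)) :
    principalMinor (Matrix.diagonal fun i => (d i : 𝕜)) S = ∏ i ∈ S, d i := by
  rw [principalMinor, Matrix.submatrix_diagonal _ _ Subtype.val_injective, Matrix.det_diagonal]
  simp only [Function.comp_apply]
  rw [Finset.prod_coe_sort S (fun i => (d i : 𝕜)), ← map_prod, RCLike.ofReal_re]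

/-- At a diagonal matrix, the logarithm of the value is linear in the `log (d i)`, with the sums on
the right as coefficients. -/
theorem MinorRatio.isHomogeneous_iff (R : MinorRatio n) :
    R.IsHomogeneous 𝕜 ↔ ∀ i, ∑ S with i ∈ S, R.log S = 0 := by
  have hval (d : Fin n → ℝ) (hd : ∀ i, 0 < d i) :
      R.value (Matrix.diagonal fun i => (d i : 𝕜)) =
        Real.exp (∑ i, (∑ S with i ∈ S, R.log S) * Real.log (d i)) := by
    rw [R.value_eq_exp]
    · congr 1
      simp only [principalMinor_diagonal_ofReal, Finset.sum_filter, Finset.sum_mul]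
      rw [Finset.sum_comm]
      refine Finset.sum_congr rfl fun S _ => ?_
      rw [Real.log_prod fun i _ => (hd i).ne', Finset.mul_sum]
      simp [ite_mul]
    · intro S
      rw [principalMinor_diagonal_ofReal]
      exact Finset.prod_pos fun i _ => hd i
  constructor
  · intro h i
    -- All `log (d j)` with `j ≠ i` vanish, which isolates the coefficient of index `i`.
    set d : Fin n → ℝ := fun j => if j = i then 2 else 1 with hd_def
    have hd : ∀ j, 0 < d j := fun j => by
      simp only [hd_def]
      split_ifs <;> norm_num
    have h1 := h (fun j => (d j : 𝕜))
      (Matrix.PosDef.diagonal fun j => by exact_mod_cast hd j)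
    rw [hval d hd, Real.exp_eq_one_iff] at h1
    simp only [hd_def, apply_ite Real.log, Real.log_one, mul_ite, mul_zero, Finset.sum_ite_eq',
      Finset.mem_univ, if_true] at h1
    exact (mul_eq_zero.1 h1).resolve_right (Real.log_pos one_lt_two).ne'
  · intro h d hd
    rw [Matrix.posDef_diagonal_iff] at hd
    have hre : d = fun i => ((RCLike.re (d i) : ℝ) : 𝕜) := by
      funext i
      exact ((RCLike.conj_eq_iff_re (K := 𝕜)).1 (hd i).le.isSelfAdjoint.star_eq).symm
    rw [hre, hval _ fun i => (RCLike.pos_iff.1 (hd i)).1]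
    simp [h]

theorem MinorRatio.sum_log_mul_card (R : MinorRatio n) (h : ∀ i, ∑ S with i ∈ S, R.log S = 0) :
    ∑ S, R.log S * (S.card : ℝ) = 0 := by
  have : ∀ S : Finset (Fin n), R.log S * (S.card : ℝ) = ∑ i, if i ∈ S then R.log S else 0 := by
    intro S
    simp [mul_comm]
  simp only [this]
  rw [Finset.sum_comm]
  simp only [← Finset.sum_filter, h, Finset.sum_const_zero]

end Values

/-! ### Column rank as a submodular function -/

section ColRank

variable {𝕜 : Type*} [RCLike 𝕜] {m n : ℕ}

/-- The dimension of the span of the columns of `M` indexed by `S`. -/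
noncomputable def colRank (M : Matrix (Fin m) (Fin n) 𝕜) (S : Finset (Fin n)) : ℕ :=
  Module.finrank 𝕜 (Submodule.span 𝕜 (M.col '' S))

theorem colRank_add_nullityType (M : Matrix (Fin m) (Fin n) 𝕜) (S : Finset (Fin n)) :
    colRank M S + nullityType M S = S.card := by
  have h := (M.submatrix id (fun i : S => (i : Fin n))).mulVecLin.finrank_range_add_finrank_ker
  rw [Matrix.range_mulVecLin] at h
  have hcol : Set.range (M.submatrix id (fun i : S => (i : Fin n))).col = M.col '' S := by
    ext v
    constructor
    · rintro ⟨i, rfl⟩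
      exact ⟨i, i.2, rfl⟩
    · rintro ⟨i, hi, rfl⟩
      exact ⟨⟨i, hi⟩, rfl⟩
  rw [hcol] at h
  simpa [colRank, nullityType] using h

theorem colRank_union_add_inter_le (M : Matrix (Fin m) (Fin n) 𝕜) (S T : Finset (Fin n)) :
    colRank M (S ∪ T) + colRank M (S ∩ T) ≤ colRank M S + colRank M T := by
  unfold colRank
  rw [← Submodule.finrank_sup_add_finrank_inf_eq (Submodule.span 𝕜 (M.col '' S)),
    Finset.coe_union, Set.image_union, Submodule.span_union]
  have hle : Submodule.span 𝕜 (M.col '' (S ∩ T : Finset (Fin n)))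
      ≤ Submodule.span 𝕜 (M.col '' S) ⊓ Submodule.span 𝕜 (M.col '' T) :=
    le_inf (Submodule.span_mono (Set.image_mono (by exact_mod_cast Finset.inter_subset_left)))
      (Submodule.span_mono (Set.image_mono (by exact_mod_cast Finset.inter_subset_right)))
  exact Nat.add_le_add_left (Submodule.finrank_mono hle) _

theorem colRank_erase (M : Matrix (Fin m) (Fin n) 𝕜) {i : Fin n} (hi : M.col i = 0)
    (S : Finset (Fin n)) : colRank M (S.erase i) = colRank M S := by
  suffices h : Submodule.span 𝕜 (M.col '' (S.erase i : Finset (Fin n)))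
      = Submodule.span 𝕜 (M.col '' S) by
    rw [colRank, h, colRank]
  refine le_antisymm (Submodule.span_mono (Set.image_mono (by simp))) ?_
  rw [Submodule.span_le]
  rintro _ ⟨j, hj, rfl⟩
  by_cases hij : j = i
  · rw [hij, hi]
    exact zero_mem _
  · exact Submodule.subset_span ⟨j, by simpa [hij] using hj, rfl⟩

theorem MinorRatio.logInner_nullityType (R : MinorRatio n)
    (hR : ∀ i, ∑ S with i ∈ S, R.log S = 0) (M : Matrix (Fin m) (Fin n) 𝕜) :
    R.logInner (nullityType M) = -∑ S, R.log S * (colRank M S : ℝ) := by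
  have h := R.sum_log_mul_card hR
  simp only [← colRank_add_nullityType M, Nat.cast_add, mul_add, Finset.sum_add_distrib] at h
  rw [logInner]
  linarith

theorem MinorRatio.logInner_nullityType_nonneg_of_col_eq_zero {R : MinorRatio n}
    (hR : ∀ i, ∑ S with i ∈ S, R.log S = 0) {M : Matrix (Fin m) (Fin n) 𝕜} {i : Fin n}
    (hi : M.col i = 0) (hK : R.deleteIndex i ∈ koteljanskiiProducts n) :
    0 ≤ R.logInner (nullityType M) := by
  rw [R.logInner_nullityType hR, neg_nonneg]
  refine sum_log_mul_nonpos_of_erase_eq hK (fun S T => ?_) fun S => ?_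
  · exact_mod_cast colRank_union_add_inter_le M S T
  · rw [colRank_erase M hi]

end ColRank

/-! ### Null spaces, orthogonal duality and reduction to two rows -/

section KernelSpace

variable {𝕜 : Type*} [RCLike 𝕜] {m n : ℕ}

/-- The null space of a matrix, inside Euclidean space. -/
noncomputable def kernelSpace (M : Matrix (Fin m) (Fin n) 𝕜) :
    Submodule 𝕜 (EuclideanSpace 𝕜 (Fin n)) :=
  LinearMap.ker (M.mulVecLin ∘ₗ (WithLp.linearEquiv 2 𝕜 (Fin n → 𝕜)).toLinearMap)

theorem mem_kernelSpace {M : Matrix (Fin m) (Fin n) 𝕜} {x : EuclideanSpace 𝕜 (Fin n)} :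
    x ∈ kernelSpace M ↔ M.mulVec x.ofLp = 0 := by
  simp [kernelSpace]

/-- The space of vectors supported on `S`. -/
def supportedOn (𝕜 : Type*) [RCLike 𝕜] {n : ℕ} (S : Finset (Fin n)) :
    Submodule 𝕜 (EuclideanSpace 𝕜 (Fin n)) where
  carrier := {x | ∀ i ∉ S, x i = 0}
  add_mem' hx hy i hi := by simp [hx i hi, hy i hi]
  zero_mem' i _ := by simp
  smul_mem' c x hx i hi := by simp [hx i hi]

theorem mem_supportedOn {S : Finset (Fin n)} {x : EuclideanSpace 𝕜 (Fin n)} :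
    x ∈ supportedOn 𝕜 S ↔ ∀ i ∉ S, x i = 0 := Iff.rfl

/-- Extension of vectors by zero. -/
noncomputable def extendZero (𝕜 : Type*) [RCLike 𝕜] {n : ℕ} (S : Finset (Fin n)) :
    (S → 𝕜) →ₗ[𝕜] EuclideanSpace 𝕜 (Fin n) where
  toFun x := WithLp.toLp 2 fun i => if h : i ∈ S then x ⟨i, h⟩ else 0
  map_add' x y := by
    ext i
    by_cases h : i ∈ S <;> simp [h]
  map_smul' c x := by
    ext i
    by_cases h : i ∈ S <;> simp [h]

theorem extendZero_apply (S : Finset (Fin n)) (x : S → 𝕜) (i : Fin n) :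
    extendZero 𝕜 S x i = if h : i ∈ S then x ⟨i, h⟩ else 0 := rfl

theorem extendZero_injective (S : Finset (Fin n)) :
    Function.Injective (extendZero 𝕜 S) := by
  intro x y h
  funext i
  have := congrArg (fun z : EuclideanSpace 𝕜 (Fin n) => z i) h
  simpa [extendZero_apply] using this

theorem mulVec_extendZero (M : Matrix (Fin m) (Fin n) 𝕜) (S : Finset (Fin n)) (x : S → 𝕜) :
    M.mulVec (extendZero 𝕜 S x).ofLp
      = (M.submatrix id (fun i : S => (i : Fin n))).mulVec x := by
  funext k
  simp only [Matrix.mulVec, dotProduct, Matrix.submatrix_apply, id_eq, extendZero_apply]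
  rw [← Finset.sum_subset (Finset.subset_univ S), ← Finset.sum_coe_sort S]
  · refine Finset.sum_congr rfl fun i _ => ?_
    rw [dif_pos i.2]
  · intro i _ hi
    rw [dif_neg hi, mul_zero]

theorem nullityType_eq_finrank_inf (M : Matrix (Fin m) (Fin n) 𝕜) (S : Finset (Fin n)) :
    nullityType M S =
      Module.finrank 𝕜 (kernelSpace M ⊓ supportedOn 𝕜 S : Submodule 𝕜 _) := by
  have : kernelSpace M ⊓ supportedOn 𝕜 S = Submodule.map (extendZero 𝕜 S)
      (LinearMap.ker (M.submatrix id (fun i : S => (i : Fin n))).mulVecLin) := by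
    ext x
    rw [Submodule.mem_inf, mem_kernelSpace, mem_supportedOn, Submodule.mem_map]
    constructor
    · rintro ⟨hx, hS⟩
      have hx' : extendZero 𝕜 S (fun i => x i) = x := by
        ext i
        rw [extendZero_apply]
        split_ifs with h
        · rfl
        · exact (hS i h).symm
      refine ⟨fun i => x i, ?_, hx'⟩
      rw [LinearMap.mem_ker, Matrix.mulVecLin_apply, ← mulVec_extendZero, hx', hx]
    · rintro ⟨y, hy, rfl⟩
      rw [LinearMap.mem_ker, Matrix.mulVecLin_apply] at hy
      refine ⟨by rw [mulVec_extendZero, hy], fun i hi => ?_⟩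
      rw [extendZero_apply, dif_neg hi]
  rw [this, nullityType]
  exact (LinearEquiv.finrank_eq (Submodule.equivMapOfInjective _ (extendZero_injective S) _))

theorem finrank_supportedOn (S : Finset (Fin n)) :
    Module.finrank 𝕜 (supportedOn 𝕜 S) = S.card := by
  -- For the matrix without rows the null space is everything and all ranks are `0`.
  have h := nullityType_eq_finrank_inf (0 : Matrix (Fin 0) (Fin n) 𝕜) S
  have h0 : kernelSpace (0 : Matrix (Fin 0) (Fin n) 𝕜) = ⊤ := by
    ext x
    simp [mem_kernelSpace]
  have h1 := colRank_add_nullityType (0 : Matrix (Fin 0) (Fin n) 𝕜) S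
  have h2 : colRank (0 : Matrix (Fin 0) (Fin n) 𝕜) S = 0 :=
    Nat.le_zero.1 ((Submodule.finrank_le _).trans (by simp))
  rw [h0, top_inf_eq] at h
  omega

theorem supportedOn_orthogonal (S : Finset (Fin n)) :
    (supportedOn 𝕜 S)ᗮ = supportedOn 𝕜 Sᶜ := by
  ext x
  rw [Submodule.mem_orthogonal, mem_supportedOn]
  constructor
  · intro h i hi
    have := h (EuclideanSpace.single i 1) (by
      intro j hj
      have : j ≠ i := by
        rintro rfl
        simp [hj] at hi
      simp [this])
    simpa [EuclideanSpace.inner_single_left] using this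
  · intro h u hu
    rw [PiLp.inner_apply]
    refine Finset.sum_eq_zero fun i _ => ?_
    by_cases hi : i ∈ S
    · rw [h i (by simpa using hi), inner_zero_right]
    · rw [hu i hi, inner_zero_left]

/-- The left intersection is the orthogonal complement of `K ⊔ supportedOn 𝕜 Sᶜ`, whose dimension
comes from the sum formula. This is matroid duality for nullities. -/
theorem finrank_orthogonal_inf_supportedOn (K : Submodule 𝕜 (EuclideanSpace 𝕜 (Fin n)))
    (S : Finset (Fin n)) :
    Module.finrank 𝕜 (Kᗮ ⊓ supportedOn 𝕜 S : Submodule 𝕜 _) + Module.finrank 𝕜 K =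
      S.card + Module.finrank 𝕜 (K ⊓ supportedOn 𝕜 Sᶜ : Submodule 𝕜 _) := by
  have h1 := Submodule.finrank_sup_add_finrank_inf_eq K (supportedOn 𝕜 Sᶜ)
  have h2 := (K ⊔ supportedOn 𝕜 Sᶜ).finrank_add_finrank_orthogonal
  rw [← Submodule.inf_orthogonal, supportedOn_orthogonal, compl_compl] at h2
  rw [finrank_supportedOn, Finset.card_compl, Fintype.card_fin] at h1
  rw [finrank_euclideanSpace_fin] at h2
  have := S.card_le_univ
  rw [Fintype.card_fin] at this
  omega

/-- `K` is the kernel of the quotient map, whose target has dimension at most `m` and embeds in `𝕜 ^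
m` by padding with zeros. -/
theorem exists_kernelSpace_eq (K : Submodule 𝕜 (EuclideanSpace 𝕜 (Fin n)))
    (h : n ≤ m + Module.finrank 𝕜 K) :
    ∃ M : Matrix (Fin m) (Fin n) 𝕜, kernelSpace M = K := by
  have hq := K.finrank_quotient_add_finrank
  rw [finrank_euclideanSpace_fin] at hq
  have hk : Module.finrank 𝕜 (EuclideanSpace 𝕜 (Fin n) ⧸ K) ≤ m := by omega
  let f : (EuclideanSpace 𝕜 (Fin n) ⧸ K) →ₗ[𝕜] (Fin m → 𝕜) :=
    Function.ExtendByZero.linearMap 𝕜 (Fin.castLE hk) ∘ₗ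
      (Module.finBasis 𝕜 (EuclideanSpace 𝕜 (Fin n) ⧸ K)).equivFun.toLinearMap
  have hf : Function.Injective f :=
    (Function.extend_injective (Fin.castLE_injective hk) 0).comp (LinearEquiv.injective _)
  let g : (Fin n → 𝕜) →ₗ[𝕜] (Fin m → 𝕜) :=
    f ∘ₗ K.mkQ ∘ₗ (WithLp.linearEquiv 2 𝕜 (Fin n → 𝕜)).symm.toLinearMap
  refine ⟨LinearMap.toMatrix' g, ?_⟩
  ext x
  rw [mem_kernelSpace, LinearMap.toMatrix'_mulVec]
  change f (K.mkQ x) = 0 ↔ _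
  rw [map_eq_zero_iff f hf, Submodule.mkQ_apply, Submodule.Quotient.mk_eq_zero]

theorem MinorRatio.sum_log_mul_const (R : MinorRatio n) (c : ℝ) : ∑ S, R.log S * c = 0 := by
  rw [← Finset.sum_mul, R.sum_log, zero_mul]

/-- Every matrix with at most five columns has the same pairing with a homogeneous
self-complementary ratio as some matrix with two rows. -/
theorem MinorRatio.exists_two_rows_logInner_eq (hn : n ≤ 5) {R : MinorRatio n}
    (hR : ∀ i, ∑ S with i ∈ S, R.log S = 0) (hc : R.IsSelfComplementary)
    (M : Matrix (Fin m) (Fin n) 𝕜) :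
    ∃ M' : Matrix (Fin 2) (Fin n) 𝕜,
      R.logInner (nullityType M) = R.logInner (nullityType M') := by
  by_cases h : n ≤ 2 + Module.finrank 𝕜 (kernelSpace M)
  · obtain ⟨M', hM'⟩ := exists_kernelSpace_eq _ h
    refine ⟨M', ?_⟩
    simp only [logInner, nullityType_eq_finrank_inf]
    rw [hM']
  · have hd := (kernelSpace M).finrank_add_finrank_orthogonal
    rw [finrank_euclideanSpace_fin] at hd
    -- Here the null space has dimension below `n - 2 ≤ 3`, so its orthogonal complement has
    -- codimension at most `2`.
    obtain ⟨M', hM'⟩ := exists_kernelSpace_eq (m := 2) (kernelSpace M)ᗮ (by omega)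
    refine ⟨M', ?_⟩
    have key : ∀ S : Finset (Fin n), (nullityType M' S : ℝ)
        = S.card + nullityType M Sᶜ - Module.finrank 𝕜 (kernelSpace M) := by
      intro S
      have := finrank_orthogonal_inf_supportedOn (kernelSpace M) S
      rw [← hM', ← nullityType_eq_finrank_inf, ← nullityType_eq_finrank_inf] at this
      rw [eq_sub_iff_add_eq]
      exact_mod_cast this
    have hcompl : ∑ S, R.log S * (nullityType M Sᶜ : ℝ) = ∑ S, R.log S * (nullityType M S : ℝ) :=
      Fintype.sum_bijective compl compl_involutive.bijective _ _ fun S => by rw [hc S]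
    -- Homogeneity removes the cardinality, the zero sum removes the constant, and
    -- self-complementarity removes the complement.
    simp only [logInner, key, mul_sub, mul_add, Finset.sum_sub_distrib, Finset.sum_add_distrib,
      hcompl, R.sum_log_mul_card hR, R.sum_log_mul_const]
    ring

end KernelSpace

/-! ### Parallel classes of columns of two-row matrices -/

section ParallelClasses

variable {𝕜 : Type*} [RCLike 𝕜] {n : ℕ}

theorem not_linearIndependent_pair_iff {V : Type*} [AddCommGroup V] [Module 𝕜 V] {v w : V}
    (hv : v ≠ 0) (hw : w ≠ 0) :
    ¬ LinearIndependent 𝕜 ![v, w] ↔ Submodule.span 𝕜 {v} = Submodule.span 𝕜 {w} := by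
  rw [LinearIndependent.pair_iff' hv, Submodule.span_singleton_eq_span_singleton]
  push Not
  constructor
  · rintro ⟨a, rfl⟩
    have ha : a ≠ 0 := by
      rintro rfl
      simp at hw
    exact ⟨Units.mk0 a ha, rfl⟩
  · rintro ⟨z, rfl⟩
    exact ⟨z, rfl⟩

open Classical in
/-- The rank of `S` when the partition `r` is that of the columns of a matrix with two rows into
parallel classes. -/
noncomputable def partitionRank (r : Setoid (Fin n)) (S : Finset (Fin n)) : ℕ :=
  if S = ∅ then 0 else if ∀ i ∈ S, ∀ j ∈ S, r i j then 1 else 2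

theorem colRank_eq_partitionRank {M : Matrix (Fin 2) (Fin n) 𝕜} {r : Setoid (Fin n)}
    (h : HasParallelClasses M r) (S : Finset (Fin n)) : colRank M S = partitionRank r S := by
  unfold partitionRank
  split_ifs with h0 h1
  · simp [h0, colRank]
  · obtain ⟨i, hi⟩ := Finset.nonempty_iff_ne_empty.2 h0
    have : Submodule.span 𝕜 (M.col '' S) = Submodule.span 𝕜 {M.col i} := by
      refine le_antisymm (Submodule.span_le.2 ?_) (Submodule.span_mono ?_)
      · rintro _ ⟨j, hj, rfl⟩
        rw [SetLike.mem_coe, (not_linearIndependent_pair_iff (h.1 i) (h.1 j)).1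
          ((h.2 i j).1 (h1 i hi j hj))]
        exact Submodule.mem_span_singleton_self _
      · rintro _ rfl
        exact ⟨i, hi, rfl⟩
    rw [colRank, this, finrank_span_singleton (h.1 i)]
  · push Not at h1
    obtain ⟨i, hi, j, hj, hij⟩ := h1
    have hli : LinearIndependent 𝕜 ![M.col i, M.col j] := by
      by_contra hcon
      exact hij ((h.2 i j).2 hcon)
    refine le_antisymm ((Submodule.finrank_le _).trans (by simp)) ?_
    have h2 := finrank_span_eq_card hli
    rw [Fintype.card_fin] at h2
    refine h2.ge.trans (Submodule.finrank_mono (Submodule.span_mono ?_))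
    rintro _ ⟨k, rfl⟩
    fin_cases k
    · exact ⟨i, hi, rfl⟩
    · exact ⟨j, hj, rfl⟩

theorem nullityType_eq_of_hasParallelClasses {r : Setoid (Fin n)}
    {M M' : Matrix (Fin 2) (Fin n) 𝕜} (h : HasParallelClasses M r)
    (h' : HasParallelClasses M' r) : nullityType M = nullityType M' := by
  funext S
  have h1 := colRank_add_nullityType M S
  have h2 := colRank_add_nullityType M' S
  rw [colRank_eq_partitionRank h] at h1
  rw [colRank_eq_partitionRank h'] at h2
  omega

theorem exists_hasParallelClasses_of_col_ne_zero (M : Matrix (Fin 2) (Fin n) 𝕜)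
    (h : ∀ i, M.col i ≠ 0) : ∃ r, HasParallelClasses M r :=
  ⟨Setoid.ker fun i => Submodule.span 𝕜 {M.col i}, h, fun i j => by
    rw [not_linearIndependent_pair_iff (h i) (h j), Setoid.ker_def]⟩

open Classical in
/-- The smallest index in the class of `i`. -/
noncomputable def minRep (r : Setoid (Fin n)) (i : Fin n) : Fin n :=
  (Finset.univ.filter (r i)).min' (Finset.filter_nonempty_iff.2 ⟨i, Finset.mem_univ i, r.refl i⟩)

theorem rel_minRep (r : Setoid (Fin n)) (i : Fin n) : r i (minRep r i) := by
  classical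
  exact (Finset.mem_filter.1 (Finset.min'_mem (Finset.univ.filter (r i)) _)).2

theorem minRep_le_of_rel {r : Setoid (Fin n)} {i j : Fin n} (h : r i j) : minRep r i ≤ j := by
  classical
  exact Finset.min'_le _ _ (Finset.mem_filter.2 ⟨Finset.mem_univ j, h⟩)

theorem minRep_le (r : Setoid (Fin n)) (i : Fin n) : minRep r i ≤ i :=
  minRep_le_of_rel (r.refl i)

theorem minRep_eq_iff {r : Setoid (Fin n)} {i j : Fin n} : minRep r i = minRep r j ↔ r i j := by
  constructor
  · intro h
    have := rel_minRep r i
    rw [h] at this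
    exact r.trans this (r.symm (rel_minRep r j))
  · intro h
    exact le_antisymm (minRep_le_of_rel (r.trans h (rel_minRep r j)))
      (minRep_le_of_rel (r.trans (r.symm h) (rel_minRep r i)))

theorem ker_minRep (r : Setoid (Fin n)) : Setoid.ker (minRep r) = r := by
  ext i j
  rw [Setoid.ker_def, minRep_eq_iff]

theorem minRep_minRep (r : Setoid (Fin n)) (i : Fin n) : minRep r (minRep r i) = minRep r i :=
  minRep_eq_iff.2 (r.symm (rel_minRep r i))

/-- Columns `(1, c)` are parallel only when the `c` agree; take for `c` the smallest index of the
class. -/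
theorem exists_hasParallelClasses (𝕜 : Type*) [RCLike 𝕜] (r : Setoid (Fin n)) :
    ∃ M : Matrix (Fin 2) (Fin n) 𝕜, HasParallelClasses M r := by
  let M : Matrix (Fin 2) (Fin n) 𝕜 := Matrix.of ![fun _ => 1, fun i => (minRep r i : ℕ)]
  have h0 : ∀ i, M.col i ≠ 0 := fun i h => by
    have := congrFun h 0
    simp [M, Matrix.col] at this
  refine ⟨M, h0, fun i j => ?_⟩
  rw [not_linearIndependent_pair_iff (h0 i) (h0 j), Submodule.span_singleton_eq_span_singleton,
    ← minRep_eq_iff]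
  constructor
  · intro h
    refine ⟨1, ?_⟩
    rw [one_smul]
    funext k
    fin_cases k <;> simp [M, Matrix.col, h]
  · rintro ⟨z, hz⟩
    have hz0 := congrFun hz 0
    have hz1 := congrFun hz 1
    simp only [M, Matrix.col, Pi.smul_apply, Units.smul_def, Matrix.transpose_apply,
      Matrix.of_apply, Matrix.cons_val_zero, Matrix.cons_val_one, smul_eq_mul, mul_one] at hz0 hz1
    rw [hz0, one_mul] at hz1
    exact Fin.ext (by exact_mod_cast hz1)

open Classical in
/-- The indicator of the finsets containing an index that satisfies `p`. -/
noncomputable def meets (p : Fin n → Prop) (S : Finset (Fin n)) : ℝ :=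
  if ∃ i ∈ S, p i then 1 else 0

theorem meets_union_add_inter_le (p : Fin n → Prop) (S T : Finset (Fin n)) :
    meets p (S ∪ T) + meets p (S ∩ T) ≤ meets p S + meets p T := by
  have hu : (∃ i ∈ S ∪ T, p i) ↔ (∃ i ∈ S, p i) ∨ ∃ i ∈ T, p i := by
    simp only [Finset.mem_union, or_and_right, exists_or]
  have hi : (∃ i ∈ S ∩ T, p i) → (∃ i ∈ S, p i) ∧ ∃ i ∈ T, p i := by
    rintro ⟨i, hi, hp⟩
    rw [Finset.mem_inter] at hi
    exact ⟨⟨i, hi.1, hp⟩, i, hi.2, hp⟩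
  unfold meets
  by_cases h1 : ∃ i ∈ S, p i <;> by_cases h2 : ∃ i ∈ T, p i <;>
    by_cases h3 : ∃ i ∈ S ∩ T, p i <;> simp only [hu, h1, h2, h3, true_or, or_true, or_self, if_true,
      if_false] <;> first | exact absurd (hi h3).1 h1 | exact absurd (hi h3).2 h2 | norm_num

theorem meets_erase {p : Fin n → Prop} {i : Fin n} (hi : ¬ p i) (S : Finset (Fin n)) :
    meets p (S.erase i) = meets p S := by
  unfold meets
  congr 1
  refine propext (exists_congr fun j => ?_)
  rw [Finset.mem_erase]
  constructor
  · exact fun h => ⟨h.1.2, h.2⟩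
  · exact fun h => ⟨⟨fun hji => hi (hji ▸ h.2), h.1⟩, h.2⟩

/-- With two classes, the rank of `S` is the number of classes that `S` meets. -/
theorem exists_partitionRank_eq_of_card_eq_two {r : Setoid (Fin n)}
    (hr : Nat.card (Quotient r) = 2) :
    ∃ p : Fin n → Prop, (∃ i, p i) ∧ (∃ i, ¬ p i) ∧
      ∀ S, (partitionRank r S : ℝ) = meets p S + meets (fun i => ¬ p i) S := by
  obtain ⟨x, y, hxy, huniv⟩ := Nat.card_eq_two_iff.1 hr
  have hmem : ∀ z : Quotient r, z = x ∨ z = y := fun z => by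
    have : z ∈ ({x, y} : Set (Quotient r)) := huniv ▸ Set.mem_univ z
    simpa using this
  obtain ⟨i, rfl⟩ := Quotient.exists_rep x
  obtain ⟨j, rfl⟩ := Quotient.exists_rep y
  have hrel : ∀ k l, r k l ↔ (Quotient.mk r k : Quotient r) = Quotient.mk r l :=
    fun k l => Quotient.eq.symm
  refine ⟨fun k => Quotient.mk r k = Quotient.mk r i, ⟨i, rfl⟩, ⟨j, hxy.symm⟩, fun S => ?_⟩
  have hnot : ∀ k, ¬ Quotient.mk r k = Quotient.mk r i → Quotient.mk r k = Quotient.mk r j :=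
    fun k hk => (hmem _).resolve_left hk
  by_cases ha : ∃ k ∈ S, Quotient.mk r k = Quotient.mk r i <;>
    by_cases hb : ∃ k ∈ S, ¬ Quotient.mk r k = Quotient.mk r i <;>
    simp only [meets, partitionRank, ha, hb, if_true, if_false]
  · obtain ⟨k, hk, hki⟩ := ha
    obtain ⟨l, hl, hli⟩ := hb
    rw [if_neg (Finset.ne_empty_of_mem hk), if_neg]
    · norm_num
    · intro h
      exact hli (((hrel l k).1 (h l hl k hk)).trans hki)
  · push Not at hb
    obtain ⟨k, hk, -⟩ := ha
    rw [if_neg (Finset.ne_empty_of_mem hk), if_pos]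
    · norm_num
    · intro l hl l' hl'
      rw [hrel, hb l hl, hb l' hl']
  · push Not at ha
    obtain ⟨k, hk, -⟩ := hb
    rw [if_neg (Finset.ne_empty_of_mem hk), if_pos]
    · norm_num
    · intro l hl l' hl'
      rw [hrel, hnot l (ha l hl), hnot l' (ha l' hl')]
  · push Not at ha hb
    rw [if_pos]
    · norm_num
    · exact Finset.eq_empty_of_forall_notMem fun k hk => ha k hk (hb k hk)

open MinorRatio in
/-- Membership in `𝓓ₙ`, `n ≤ 5`, can be tested on matrices with two rows and without zero column
whose columns do not form exactly two parallel classes. -/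
theorem mem_dualNullity_iff (hn : n ≤ 5) {R : MinorRatio n} (hR : R.IsHomogeneous 𝕜)
    (hc : R.IsSelfComplementary) (hK : ∀ i, R.deleteIndex i ∈ koteljanskiiProducts n) :
    R ∈ dualNullity 𝕜 n ↔ ∀ r : Setoid (Fin n), Nat.card (Quotient r) ≠ 2 →
      ∀ M : Matrix (Fin 2) (Fin n) 𝕜, HasParallelClasses M r →
        0 ≤ R.logInner (nullityType M) := by
  refine ⟨fun h r _ M _ => h.2 2 M, fun h => ⟨hR, fun m M => ?_⟩⟩
  have hR' := R.isHomogeneous_iff.1 hR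
  obtain ⟨M', hM'⟩ := exists_two_rows_logInner_eq hn hR' hc M
  rw [hM']
  by_cases h0 : ∃ i, M'.col i = 0
  · obtain ⟨i, hi⟩ := h0
    exact logInner_nullityType_nonneg_of_col_eq_zero hR' hi (hK i)
  · push Not at h0
    obtain ⟨r, hr⟩ := exists_hasParallelClasses_of_col_ne_zero M' h0
    by_cases h2 : Nat.card (Quotient r) = 2
    · obtain ⟨p, ⟨i, hi⟩, ⟨j, hj⟩, hp⟩ := exists_partitionRank_eq_of_card_eq_two h2
      rw [R.logInner_nullityType hR']
      simp only [colRank_eq_partitionRank hr, hp, mul_add, Finset.sum_add_distrib]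
      -- The indicator for the class `p` ignores `j`, which lies outside it; that of the other class
      -- ignores `i`.
      have h1 := sum_log_mul_nonpos_of_erase_eq (hK j) (meets_union_add_inter_le p)
        (meets_erase hj)
      have h2 := sum_log_mul_nonpos_of_erase_eq (hK i)
        (meets_union_add_inter_le fun k => ¬ p k) (meets_erase (not_not.2 hi))
      linarith
    · exact h r h2 M' hr

end ParallelClasses

/-! ### Counting partitions by least representatives -/

section Counting

/-- Such a map sends `i` to the least element of its fiber, so the fibers determine it. -/
theorem eq_of_ker_eq_of_idempotent {n : ℕ} {f g : Fin n → Fin n}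
    (hf : ∀ i, f i ≤ i ∧ f (f i) = f i) (hg : ∀ i, g i ≤ i ∧ g (g i) = g i)
    (h : Setoid.ker f = Setoid.ker g) : f = g := by
  have hiff : ∀ i j, f i = f j ↔ g i = g j := fun i j => by
    rw [← Setoid.ker_def, ← Setoid.ker_def, h]
  funext i
  refine le_antisymm ?_ ?_
  · rw [← (hiff (g i) i).2 (hg i).2]
    exact (hf _).1
  · rw [← (hiff (f i) i).1 (hf i).2]
    exact (hg _).1

theorem card_quotient_ker {n : ℕ} (f : Fin n → Fin n) :
    Nat.card (Quotient (Setoid.ker f)) = (Finset.univ.image f).card := by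
  rw [Nat.card_congr (Setoid.quotientKerEquivRange f), Nat.card_coe_set_eq, ← Set.image_univ,
    ← Finset.coe_univ, ← Finset.coe_image, Set.ncard_coe_finset]

/-- The canonical representative maps of the partitions whose number of blocks is not `2`. -/
def minRepMaps (n : ℕ) : Finset (Fin n → Fin n) :=
  {f | (∀ i, f i ≤ i ∧ f (f i) = f i) ∧ (Finset.univ.image f).card ≠ 2}

theorem ncard_setoid_card_quotient_ne_two (n : ℕ) :
    {r : Setoid (Fin n) | Nat.card (Quotient r) ≠ 2}.ncard = (minRepMaps n).card := by
  rw [← Set.ncard_coe_finset]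
  symm
  refine Set.ncard_congr (fun f _ => Setoid.ker f) ?_ ?_ ?_
  · intro f hf
    simp only [minRepMaps, Finset.coe_filter, Finset.mem_univ, true_and] at hf
    change Nat.card (Quotient (Setoid.ker f)) ≠ 2
    rw [card_quotient_ker]
    exact hf.2
  · intro f g hf hg h
    simp only [minRepMaps, Finset.coe_filter, Finset.mem_univ, true_and] at hf hg
    exact eq_of_ker_eq_of_idempotent hf.1 hg.1 h
  · intro r hr
    refine ⟨minRep r, ?_, ker_minRep r⟩
    simp only [minRepMaps, Finset.coe_filter, Finset.mem_univ, true_and]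
    refine ⟨fun i => ⟨minRep_le r i, minRep_minRep r i⟩, ?_⟩
    rw [← card_quotient_ker, ker_minRep]
    exact hr

theorem card_minRepMaps_five : (minRepMaps 5).card = 37 := by
  decide +kernel

end Counting

/-! ### Finite verification for `Q` -/

section RatioQ

open MinorRatio

/-- The formal logarithm of `ratioQ`, with integer values. -/
def ratioQLog (S : Finset (Fin 5)) : ℤ :=
  (if S ∈ ({{0, 1, 2, 3, 4}, {0, 2, 3, 4}, {1, 2, 3, 4}, {0, 1, 2}, {0, 1, 4}, {2, 3},
    {3, 4}, {0}, {1}, ∅} : Finset (Finset (Fin 5))) then 1 else 0) -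
  (if S ∈ ({{0, 1, 2, 3}, {0, 1, 2, 4}, {0, 3, 4}, {1, 3, 4}, {2, 3, 4}, {0, 1}, {0, 2},
    {1, 2}, {3}, {4}} : Finset (Finset (Fin 5))) then 1 else 0)

theorem log_ratioQ : ratioQ.log = fun S => (ratioQLog S : ℝ) := by
  apply log_eq_of_sum_eq_zero
  · rw [← Int.cast_sum, Int.cast_eq_zero]
    decide +kernel
  · intro S _
    simp only [ratioQLog, ratioQ, Int.cast_sub, Int.cast_ite, Int.cast_one, Int.cast_zero,
      apply_ite NNReal.toReal, NNReal.coe_one, NNReal.coe_zero]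

theorem isSelfComplementary_ratioQ : ratioQ.IsSelfComplementary := by
  intro S
  rw [log_ratioQ]
  have : ∀ S, ratioQLog Sᶜ = ratioQLog S := by decide +kernel
  exact congrArg _ (this S)

theorem sum_log_ratioQ_filter_mem (i : Fin 5) : ∑ S with i ∈ S, ratioQ.log S = 0 := by
  have : ∀ i : Fin 5, ∑ S with i ∈ S, ratioQLog S = 0 := by decide +kernel
  simp only [log_ratioQ]
  exact_mod_cast this i

/-- For each index, the Koteljanskii ratios whose product is `ratioQ` with that index deleted. -/
def ratioQFactors : Fin 5 → List (Finset (Fin 5) × Finset (Fin 5)) :=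
  ![[({1, 2, 4}, {1, 2, 3}), ({1, 3, 4}, {1, 2, 3}), ({1, 3}, {1, 2}), ({4}, {1}), ({3}, {2})],
    [({0, 2, 4}, {0, 2, 3}), ({0, 3, 4}, {0, 2, 3}), ({0, 3}, {0, 2}), ({4}, {0}), ({3}, {2})],
    [({0, 1, 4}, {0, 1, 3}), ({0, 4}, {0, 1}), ({4}, {0})],
    [({1, 4}, {1, 2}), ({2, 4}, {0, 2}), ({0, 4}, {0, 1})],
    [({1, 3}, {1, 2}), ({0, 3}, {0, 2})]]

theorem deleteIndex_ratioQ_mem (i : Fin 5) : ratioQ.deleteIndex i ∈ koteljanskiiProducts 5 := by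
  have h : ∀ (i : Fin 5) (U : Finset (Fin 5)), ∑ S with S.erase i = U, ratioQLog S =
      ((ratioQFactors i).map fun p => koteljanskiiLog p.1 p.2 U).sum := by decide +kernel
  refine mem_koteljanskiiProducts_of_list (ratioQFactors i) fun U => ?_
  rw [log_deleteIndex, log_ratioQ, ← h i U]
  push_cast
  rfl

/-- The rank of `S` for the partition into the fibers of `f`. -/
def fiberRank (f : Fin 5 → Fin 5) (S : Finset (Fin 5)) : ℤ :=
  if S = ∅ then 0 else if ∀ i ∈ S, ∀ j ∈ S, f i = f j then 1 else 2

theorem sum_ratioQLog_mul_fiberRank_nonpos (f : Fin 5 → Fin 5) (hf : ∀ i, f i ≤ i) :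
    ∑ S, ratioQLog S * fiberRank f S ≤ 0 := by
  -- These are all 120 maps with `f i ≤ i`. They include every least-representative map, so
  -- idempotence need not be imposed.
  have h : ∀ (a : Fin 2) (b : Fin 3) (c : Fin 4) (d : Fin 5),
      ∑ S, ratioQLog S * fiberRank ![0, a.castLE (by decide), b.castLE (by decide),
        c.castLE (by decide), d] S ≤ 0 := by decide +kernel
  have h0 := hf 0
  have h1 := hf 1
  have h2 := hf 2
  have h3 := hf 3
  convert h ⟨f 1, by omega⟩ ⟨f 2, by omega⟩ ⟨f 3, by omega⟩ (f 4) using 4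
  funext i
  fin_cases i
  · exact Fin.le_zero_iff.1 h0
  all_goals rfl

theorem ratioQ_mem_dualNullity (𝕜 : Type*) [RCLike 𝕜] : ratioQ ∈ dualNullity 𝕜 5 := by
  refine (mem_dualNullity_iff le_rfl (ratioQ.isHomogeneous_iff.2 sum_log_ratioQ_filter_mem)
    isSelfComplementary_ratioQ deleteIndex_ratioQ_mem).2 fun r _ M hM => ?_
  rw [ratioQ.logInner_nullityType sum_log_ratioQ_filter_mem, neg_nonneg]
  simp only [log_ratioQ]
  have hr : ∀ S, (partitionRank r S : ℤ) = fiberRank (minRep r) S := by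
    intro S
    unfold partitionRank fiberRank
    split_ifs with h0 h1 h2 h2
    · rfl
    · rfl
    · exact absurd (fun i hi j hj => minRep_eq_iff.2 (h1 i hi j hj)) h2
    · exact absurd (fun i hi j hj => minRep_eq_iff.1 (h2 i hi j hj)) h1
    · rfl
  have := sum_ratioQLog_mul_fiberRank_nonpos (minRep r) (minRep_le r)
  simp only [← hr, ← colRank_eq_partitionRank hM] at this
  exact_mod_cast this

end RatioQ

/-! ### Growth of ratios along polynomial Gram families -/

section Asymptotics

open Filter Topology

variable {𝕜 : Type*} [RCLike 𝕜] {n : ℕ} {P : Matrix (Fin n) (Fin n) 𝕜[X]}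

theorem tendsto_log_principalMinor_sub {S : Finset (Fin n)} {k : ℕ} {C : ℝ} (hC : 0 < C)
    (h : Asymptotics.IsEquivalent (𝓝[≠] (0 : ℝ)) (fun ε : ℝ => principalMinor (gramFamily P ε) S)
      (fun ε : ℝ => C * ε ^ (2 * k))) :
    Tendsto (fun ε : ℝ => Real.log (principalMinor (gramFamily P ε) S) - 2 * k * Real.log ε)
      (𝓝[>] 0) (𝓝 (Real.log C)) := by
  have hpos : ∀ᶠ ε : ℝ in 𝓝[>] 0, 0 < ε := self_mem_nhdsWithin
  have h' := h.mono (nhdsWithin_mono _ fun x (hx : 0 < x) => hx.ne' : 𝓝[>] (0 : ℝ) ≤ 𝓝[≠] 0)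
  rw [Asymptotics.isEquivalent_iff_tendsto_one (hpos.mono fun ε hε => by positivity)] at h'
  have hlog := ((Real.continuousAt_log one_ne_zero).tendsto.comp h').const_add (Real.log C)
  rw [Real.log_one, add_zero] at hlog
  refine hlog.congr' ?_
  filter_upwards [hpos, h'.eventually_ne one_ne_zero] with ε hε hne
  have hm : principalMinor (gramFamily P ε) S ≠ 0 := by
    intro h0
    simp [h0] at hne
  have hp : ε ^ (2 * k) ≠ 0 := by positivity
  simp only [Function.comp_apply, Pi.div_apply]
  rw [Real.log_div hm (mul_ne_zero hC.ne' hp), Real.log_mul hC.ne' hp, Real.log_pow]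
  push_cast
  ring

theorem tendsto_log_nhdsGT_zero_atBot : Tendsto Real.log (𝓝[>] 0) atBot :=
  Real.tendsto_log_nhdsNE_zero.mono_left (nhdsWithin_mono _ fun _ hx => ne_of_gt hx)

theorem IsAsymptoticNullityType.unique {d d' : Finset (Fin n) → ℕ}
    (h : IsAsymptoticNullityType P d) (h' : IsAsymptoticNullityType P d') : d = d' := by
  funext S
  obtain ⟨C, hC, hd⟩ := h S
  obtain ⟨C', hC', hd'⟩ := h' S
  by_contra hne
  have hsub : (2 * d' S - 2 * d S : ℝ) ≠ 0 := by
    intro h0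
    apply hne
    have : (d S : ℝ) = d' S := by linarith
    exact_mod_cast this
  have ht := ((tendsto_log_principalMinor_sub hC hd).sub
    (tendsto_log_principalMinor_sub hC' hd')).div_const (2 * d' S - 2 * d S : ℝ)
  -- Two different exponents would make `log ε` converge.
  refine not_tendsto_nhds_of_tendsto_atBot tendsto_log_nhdsGT_zero_atBot _ (ht.congr fun ε => ?_)
  rw [div_eq_iff hsub]
  ring

/-- The logarithm of the value is `2 * R.logInner d * log ε` plus a convergent term, and `log ε`
tends to `-∞`. -/
theorem MinorRatio.tendsto_value_gramFamily_atTop (R : MinorRatio n) {d : Finset (Fin n) → ℕ}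
    (hd : IsAsymptoticNullityType P d) (hP : ∀ ε : ℝ, 0 < ε → (gramFamily P ε).PosDef)
    (hR : R.logInner d < 0) :
    Tendsto (fun ε : ℝ => R.value (gramFamily P ε)) (𝓝[>] 0) atTop := by
  choose C hC h using hd
  have h1 : Tendsto (fun ε : ℝ => ∑ S, R.log S *
      (Real.log (principalMinor (gramFamily P ε) S) - 2 * d S * Real.log ε)) (𝓝[>] 0)
      (𝓝 (∑ S, R.log S * Real.log (C S))) :=
    tendsto_finsetSum _ fun S _ => (tendsto_log_principalMinor_sub (hC S) (h S)).const_mul _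
  have h2 : Tendsto (fun ε : ℝ => 2 * R.logInner d * Real.log ε) (𝓝[>] 0) atTop :=
    tendsto_log_nhdsGT_zero_atBot.const_mul_atBot_of_neg (by linarith)
  refine Tendsto.congr' ?_ (Real.tendsto_exp_atTop.comp (h2.atTop_add h1))
  filter_upwards [self_mem_nhdsWithin] with ε hε
  rw [R.value_eq_exp fun S => (hP ε hε).principalMinor_pos S, Function.comp_apply]
  congr 1
  rw [logInner, Finset.mul_sum, Finset.sum_mul, ← Finset.sum_add_distrib]
  exact Finset.sum_congr rfl fun S _ => by ring

theorem MinorRatio.notMem_boundedRatios_of_logInner_neg {R : MinorRatio n}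
    {d : Finset (Fin n) → ℕ} (hd : IsAsymptoticNullityType P d)
    (hP : ∀ ε : ℝ, 0 < ε → (gramFamily P ε).PosDef) (hR : R.logInner d < 0) :
    R ∉ boundedRatios 𝕜 n := by
  rintro ⟨C, hC⟩
  obtain ⟨ε, h1, h2⟩ := (((R.tendsto_value_gramFamily_atTop hd hP hR).eventually_gt_atTop C).and
    self_mem_nhdsWithin).exists
  exact absurd (hC _ (hP ε h2)) (not_le.2 h1)

end Asymptotics

/-! ### Laplace expansions with explicit index vectors -/

section Determinants

theorem Matrix.det_fin_four {R : Type*} [CommRing R] (A : Matrix (Fin 4) (Fin 4) R) :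
    A.det = A 0 0 * (A.submatrix ![1, 2, 3] ![1, 2, 3]).det
      - A 0 1 * (A.submatrix ![1, 2, 3] ![0, 2, 3]).det
      + A 0 2 * (A.submatrix ![1, 2, 3] ![0, 1, 3]).det
      - A 0 3 * (A.submatrix ![1, 2, 3] ![0, 1, 2]).det := by
  rw [Matrix.det_succ_row_zero]
  have h0 : (Fin.succ : Fin 3 → Fin 4) = ![1, 2, 3] := by decide
  have e0 : (0 : Fin 4).succAbove = ![1, 2, 3] := by decide
  have e1 : (1 : Fin 4).succAbove = ![0, 2, 3] := by decide
  have e2 : (2 : Fin 4).succAbove = ![0, 1, 3] := by decide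
  have e3 : (3 : Fin 4).succAbove = ![0, 1, 2] := by decide
  rw [Fin.sum_univ_four, h0, e0, e1, e2, e3]
  simp
  ring

theorem Matrix.det_fin_five {R : Type*} [CommRing R] (A : Matrix (Fin 5) (Fin 5) R) :
    A.det = A 0 0 * (A.submatrix ![1, 2, 3, 4] ![1, 2, 3, 4]).det
      - A 0 1 * (A.submatrix ![1, 2, 3, 4] ![0, 2, 3, 4]).det
      + A 0 2 * (A.submatrix ![1, 2, 3, 4] ![0, 1, 3, 4]).det
      - A 0 3 * (A.submatrix ![1, 2, 3, 4] ![0, 1, 2, 4]).det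
      + A 0 4 * (A.submatrix ![1, 2, 3, 4] ![0, 1, 2, 3]).det := by
  rw [Matrix.det_succ_row_zero]
  have h0 : (Fin.succ : Fin 4 → Fin 5) = ![1, 2, 3, 4] := by decide
  have e0 : (0 : Fin 5).succAbove = ![1, 2, 3, 4] := by decide
  have e1 : (1 : Fin 5).succAbove = ![0, 2, 3, 4] := by decide
  have e2 : (2 : Fin 5).succAbove = ![0, 1, 3, 4] := by decide
  have e3 : (3 : Fin 5).succAbove = ![0, 1, 2, 4] := by decide
  have e4 : (4 : Fin 5).succAbove = ![0, 1, 2, 3] := by decide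
  rw [Fin.sum_univ_five, h0, e0, e1, e2, e3, e4]
  simp
  ring

end Determinants

/-! ### The Gram family of `P` and its asymptotic nullity type -/

section MatrixP

open Filter Topology

/-- The evaluation of `matrixP`, with real entries. -/
def realMatrixP (ε : ℝ) : Matrix (Fin 5) (Fin 5) ℝ :=
  !![1, 1, 1, 1, 1;
     0, ε, 0, 1, 2;
     0, 0, ε, 1, 2;
     0, 0, 0, ε, 0;
     0, 0, 0, 0, ε]

/-- The Gram matrix of the columns of `realMatrixP ε`. -/
def realGramP (ε : ℝ) : Matrix (Fin 5) (Fin 5) ℝ :=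
  !![1, 1, 1, 1, 1;
     1, 1 + ε ^ 2, 1, 1 + ε, 1 + 2 * ε;
     1, 1, 1 + ε ^ 2, 1 + ε, 1 + 2 * ε;
     1, 1 + ε, 1 + ε, 3 + ε ^ 2, 5;
     1, 1 + 2 * ε, 1 + 2 * ε, 5, 9 + ε ^ 2]

theorem transpose_mul_realMatrixP (ε : ℝ) :
    (realMatrixP ε).transpose * realMatrixP ε = realGramP ε := by
  ext i j
  fin_cases i <;> fin_cases j <;>
    simp [realMatrixP, realGramP, Matrix.mul_apply, Fin.sum_univ_succ] <;> ring

theorem det_realMatrixP (ε : ℝ) : (realMatrixP ε).det = ε ^ 4 := by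
  rw [Matrix.det_of_isUpperTriangular]
  · simp [realMatrixP, Fin.prod_univ_succ]
    ring
  · intro i j hij
    fin_cases i <;> fin_cases j <;> first | rfl | exact absurd hij (by decide)

variable {𝕜 : Type*} [RCLike 𝕜]

theorem map_eval_matrixP (ε : ℝ) :
    (matrixP 𝕜).map (Polynomial.eval (ε : 𝕜)) = (realMatrixP ε).map (RCLike.ofReal (K := 𝕜)) := by
  ext i j
  fin_cases i <;> fin_cases j <;> simp [matrixP, realMatrixP, RCLike.ofReal_ofNat]

theorem gramFamily_matrixP (ε : ℝ) :
    gramFamily (matrixP 𝕜) ε = (realGramP ε).map (RCLike.ofReal (K := 𝕜)) := by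
  have h : ((realMatrixP ε).map (RCLike.ofReal (K := 𝕜))).conjTranspose
      = (realMatrixP ε).transpose.map (RCLike.ofReal (K := 𝕜)) := by
    ext i j
    simp [Matrix.conjTranspose_apply]
  rw [gramFamily, map_eval_matrixP, h, ← transpose_mul_realMatrixP]
  exact ((realMatrixP ε).transpose.map_mul (M := realMatrixP ε)
    (f := algebraMap ℝ 𝕜)).symm

theorem posDef_gramFamily_matrixP {ε : ℝ} (hε : ε ≠ 0) : (gramFamily (matrixP 𝕜) ε).PosDef := by
  refine Matrix.PosDef.conjTranspose_mul_self _ (Matrix.mulVec_injective_of_det_ne_zero ?_)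
  have h := (algebraMap ℝ 𝕜).map_det (realMatrixP ε)
  rw [det_realMatrixP] at h
  rw [map_eval_matrixP]
  change ((algebraMap ℝ 𝕜).mapMatrix (realMatrixP ε)).det ≠ 0
  rw [← h, map_ne_zero]
  exact pow_ne_zero _ hε

theorem principalMinor_gramFamily_matrixP {k : ℕ} {f : Fin k → Fin 5} (hf : f.Injective)
    (ε : ℝ) : principalMinor (gramFamily (matrixP 𝕜) ε) (Finset.univ.image f)
      = ((realGramP ε).submatrix f f).det := by
  let e : Fin k ≃ (Finset.univ.image f : Finset (Fin 5)) :=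
    Equiv.ofBijective (fun i => ⟨f i, Finset.mem_image_of_mem f (Finset.mem_univ i)⟩)
      ⟨fun i j h => hf (congrArg Subtype.val h), fun ⟨y, hy⟩ => by
        obtain ⟨i, -, rfl⟩ := Finset.mem_image.1 hy
        exact ⟨i, rfl⟩⟩
  rw [principalMinor, gramFamily_matrixP, ← Matrix.det_submatrix_equiv_self e]
  have h := (algebraMap ℝ 𝕜).map_det ((realGramP ε).submatrix f f)
  change (((realGramP ε).submatrix f f).det : 𝕜) = _ at h
  rw [← RCLike.ofReal_re (K := 𝕜) ((realGramP ε).submatrix f f).det, h]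
  rfl

/-- The asymptotic nullity type of `matrixP`. -/
def asymptoticNullityP (S : Finset (Fin 5)) : ℕ :=
  -- The subtraction truncates at `0`. `P(0)` has rank `2`, and its columns `0`, `1`, `2` coincide.
  S.card - 2 + if {0, 1, 2} ⊆ S ∨ S = {0, 1} ∨ S = {0, 2} ∨ S = {1, 2} then 1 else 0

set_option maxHeartbeats 1000000 in
-- Each `g` is the Gram minor divided by its exact power of `ε`; `g 0` is the leading coefficient.
theorem exists_det_realGramP_eq (S : Finset (Fin 5)) :
    ∃ (k d : ℕ) (f : Fin k → Fin 5) (g : ℝ → ℝ),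
      (f.Injective ∧ Finset.univ.image f = S ∧ asymptoticNullityP S = d) ∧
      Continuous g ∧ 0 < g 0 ∧ ∀ ε, ((realGramP ε).submatrix f f).det = ε ^ (2 * d) * g ε := by
  have hS : ∀ S : Finset (Fin 5), S ∈ ([
      ∅, {0}, {1}, {2}, {3}, {4}, {0, 1}, {0, 2}, {0, 3}, {0, 4}, {1, 2}, {1, 3}, {1, 4}, {2, 3},
      {2, 4}, {3, 4}, {0, 1, 2}, {0, 1, 3}, {0, 1, 4}, {0, 2, 3}, {0, 2, 4}, {0, 3, 4}, {1, 2, 3},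
      {1, 2, 4}, {1, 3, 4}, {2, 3, 4}, {0, 1, 2, 3}, {0, 1, 2, 4}, {0, 1, 3, 4}, {0, 2, 3, 4},
      {1, 2, 3, 4}, {0, 1, 2, 3, 4}] : List (Finset (Fin 5))) := by
    decide +kernel
  replace hS := hS S
  simp only [List.mem_cons, List.not_mem_nil, or_false] at hS
  rcases hS with rfl | rfl | rfl | rfl | rfl | rfl | rfl | rfl | rfl | rfl | rfl | rfl | rfl | rfl
  | rfl | rfl | rfl | rfl | rfl | rfl | rfl | rfl | rfl | rfl | rfl | rfl | rfl | rfl | rfl | rfl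
  | rfl | rfl <;>
  [ refine ⟨_, 0, ![], fun _ => 1, ?_⟩;
    refine ⟨_, 0, ![0], fun _ => 1, ?_⟩;
    refine ⟨_, 0, ![1], fun ε => 1 + ε ^ 2, ?_⟩;
    refine ⟨_, 0, ![2], fun ε => 1 + ε ^ 2, ?_⟩;
    refine ⟨_, 0, ![3], fun ε => 3 + ε ^ 2, ?_⟩;
    refine ⟨_, 0, ![4], fun ε => 9 + ε ^ 2, ?_⟩;
    refine ⟨_, 1, ![0, 1], fun _ => 1, ?_⟩;
    refine ⟨_, 1, ![0, 2], fun _ => 1, ?_⟩;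
    refine ⟨_, 0, ![0, 3], fun ε => 2 + ε ^ 2, ?_⟩;
    refine ⟨_, 0, ![0, 4], fun ε => 8 + ε ^ 2, ?_⟩;
    refine ⟨_, 1, ![1, 2], fun ε => 2 + ε ^ 2, ?_⟩;
    refine ⟨_, 0, ![1, 3], fun ε => 2 - 2 * ε + 3 * ε ^ 2 + ε ^ 4, ?_⟩;
    refine ⟨_, 0, ![1, 4], fun ε => 8 - 4 * ε + 6 * ε ^ 2 + ε ^ 4, ?_⟩;
    refine ⟨_, 0, ![2, 3], fun ε => 2 - 2 * ε + 3 * ε ^ 2 + ε ^ 4, ?_⟩;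
    refine ⟨_, 0, ![2, 4], fun ε => 8 - 4 * ε + 6 * ε ^ 2 + ε ^ 4, ?_⟩;
    refine ⟨_, 0, ![3, 4], fun ε => 2 + 12 * ε ^ 2 + ε ^ 4, ?_⟩;
    refine ⟨_, 2, ![0, 1, 2], fun _ => 1, ?_⟩;
    refine ⟨_, 1, ![0, 1, 3], fun ε => 1 + ε ^ 2, ?_⟩;
    refine ⟨_, 1, ![0, 1, 4], fun ε => 4 + ε ^ 2, ?_⟩;
    refine ⟨_, 1, ![0, 2, 3], fun ε => 1 + ε ^ 2, ?_⟩;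
    refine ⟨_, 1, ![0, 2, 4], fun ε => 4 + ε ^ 2, ?_⟩;
    refine ⟨_, 1, ![0, 3, 4], fun ε => 10 + ε ^ 2, ?_⟩;
    refine ⟨_, 1, ![1, 2, 3], fun ε => 4 - 4 * ε + 3 * ε ^ 2 + ε ^ 4, ?_⟩;
    refine ⟨_, 1, ![1, 2, 4], fun ε => 16 - 8 * ε + 3 * ε ^ 2 + ε ^ 4, ?_⟩;
    refine ⟨_, 1, ![1, 3, 4], fun ε => 11 - 6 * ε + 8 * ε ^ 2 + ε ^ 4, ?_⟩;
    refine ⟨_, 1, ![2, 3, 4], fun ε => 11 - 6 * ε + 8 * ε ^ 2 + ε ^ 4, ?_⟩;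
    refine ⟨_, 3, ![0, 1, 2, 3], fun _ => 1, ?_⟩;
    refine ⟨_, 3, ![0, 1, 2, 4], fun _ => 1, ?_⟩;
    refine ⟨_, 2, ![0, 1, 3, 4], fun ε => 5 + ε ^ 2, ?_⟩;
    refine ⟨_, 2, ![0, 2, 3, 4], fun ε => 5 + ε ^ 2, ?_⟩;
    refine ⟨_, 2, ![1, 2, 3, 4], fun ε => 20 - 12 * ε + 4 * ε ^ 2 + ε ^ 4, ?_⟩;
    refine ⟨_, 4, ![0, 1, 2, 3, 4], fun _ => 1, ?_⟩ ]
  all_goals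
    refine ⟨by decide +kernel, by fun_prop, by norm_num, fun ε => ?_⟩
    simp only [Matrix.det_fin_zero, Matrix.det_fin_one, Matrix.det_fin_two, Matrix.det_fin_three,
      Matrix.det_fin_four, Matrix.det_fin_five, Matrix.submatrix_apply]
    simp [realGramP]
    try ring

theorem isAsymptoticNullityType_matrixP :
    IsAsymptoticNullityType (matrixP 𝕜) asymptoticNullityP := by
  intro S
  obtain ⟨k, d, f, g, ⟨hf, hS, hd⟩, hg, h0, hdet⟩ := exists_det_realGramP_eq S
  refine ⟨g 0, h0, ?_⟩
  have hmul : (fun ε : ℝ => principalMinor (gramFamily (matrixP 𝕜) ε) S)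
      = fun ε => g ε * ε ^ (2 * asymptoticNullityP S) := by
    funext ε
    rw [hd, ← hS, principalMinor_gramFamily_matrixP hf, hdet, mul_comm]
  rw [hmul]
  refine Asymptotics.IsEquivalent.mul ?_ Asymptotics.IsEquivalent.refl
  refine (Asymptotics.isEquivalent_const_iff_tendsto h0.ne').2 ?_
  exact hg.continuousAt.tendsto.mono_left nhdsWithin_le_nhds

theorem logInner_ratioQ_asymptoticNullityP : ratioQ.logInner asymptoticNullityP = -1 := by
  have : ∑ S, ratioQLog S * (asymptoticNullityP S : ℤ) = -1 := by decide +kernel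
  simp only [MinorRatio.logInner, log_ratioQ]
  exact_mod_cast this

end MatrixP

theorem mainTheorem5 (𝕜 : Type*) [RCLike 𝕜] :
    -- `Q` is self-complementary, and deleting any index gives a product of Koteljanskii ratios
    (ratioQ.IsSelfComplementary ∧ ∀ i, ratioQ.deleteIndex i ∈ koteljanskiiProducts 5) ∧
    -- `Q` lies in `𝓓₅`
    ratioQ ∈ dualNullity 𝕜 5 ∧
    -- for such ratios membership in `𝓓₅` reduces to `37` partitions of the columns of rank `≤ 2`
    -- matrices into parallel classes, each of which determines a single nullity type
    ({r : Setoid (Fin 5) | Nat.card (Quotient r) ≠ 2}.ncard = 37 ∧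
      (∀ r : Setoid (Fin 5), ∃ M : Matrix (Fin 2) (Fin 5) 𝕜, HasParallelClasses M r) ∧
      (∀ (r : Setoid (Fin 5)) (M M' : Matrix (Fin 2) (Fin 5) 𝕜),
        HasParallelClasses M r → HasParallelClasses M' r → nullityType M = nullityType M') ∧
      ∀ R : MinorRatio 5, R.IsHomogeneous 𝕜 → R.IsSelfComplementary →
        (∀ i, R.deleteIndex i ∈ koteljanskiiProducts 5) →
        (R ∈ dualNullity 𝕜 5 ↔
          ∀ r : Setoid (Fin 5), Nat.card (Quotient r) ≠ 2 →
            ∀ M : Matrix (Fin 2) (Fin 5) 𝕜, HasParallelClasses M r →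
              0 ≤ R.logInner (nullityType M))) ∧
    -- `P` has a unique asymptotic nullity type, whose inner product with `log Q` is `-1`
    (∃ d : Finset (Fin 5) → ℕ, IsAsymptoticNullityType (matrixP 𝕜) d ∧
      (∀ d', IsAsymptoticNullityType (matrixP 𝕜) d' → d' = d) ∧ ratioQ.logInner d = -1) ∧
    -- the matrices `A_ε` are positive definite, and `Q` is unbounded along them as `ε → 0`
    (∀ ε : ℝ, 0 < ε → (gramFamily (matrixP 𝕜) ε).PosDef) ∧
    Filter.Tendsto (fun ε : ℝ => ratioQ.value (gramFamily (matrixP 𝕜) ε))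
      (nhdsWithin 0 (Set.Ioi 0)) Filter.atTop ∧
    -- hence `𝓑₅ ≠ 𝓓₅`, also up to equivalence of ratios
    ratioQ ∉ boundedRatios 𝕜 5 ∧
    boundedRatios 𝕜 5 ≠ dualNullity 𝕜 5 ∧
    MinorRatio.log '' boundedRatios 𝕜 5 ≠ MinorRatio.log '' dualNullity 𝕜 5 := by
  have hasn := isAsymptoticNullityType_matrixP (𝕜 := 𝕜)
  have hPD : ∀ ε : ℝ, 0 < ε → (gramFamily (matrixP 𝕜) ε).PosDef :=
    fun ε hε => posDef_gramFamily_matrixP hε.ne'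
  have hinner := logInner_ratioQ_asymptoticNullityP
  have hneg : ratioQ.logInner asymptoticNullityP < 0 := by rw [hinner]; norm_num
  have hD := ratioQ_mem_dualNullity 𝕜
  have hB := MinorRatio.notMem_boundedRatios_of_logInner_neg hasn hPD hneg
  refine ⟨⟨isSelfComplementary_ratioQ, deleteIndex_ratioQ_mem⟩, hD,
    ⟨(ncard_setoid_card_quotient_ne_two 5).trans card_minRepMaps_five,
      exists_hasParallelClasses 𝕜, fun r M M' => nullityType_eq_of_hasParallelClasses,
      fun R => mem_dualNullity_iff le_rfl⟩,
    ⟨asymptoticNullityP, hasn, fun d' hd' => hd'.unique hasn, hinner⟩, hPD,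
    ratioQ.tendsto_value_gramFamily_atTop hasn hPD hneg, hB, fun h => hB (h ▸ hD), fun h => ?_⟩
  -- A bounded `R` with the logarithm of `Q` would also pair to `-1` with the asymptotic nullity
  -- type.
  obtain ⟨R, hR, hlog⟩ := h ▸ Set.mem_image_of_mem MinorRatio.log hD
  refine MinorRatio.notMem_boundedRatios_of_logInner_neg hasn hPD ?_ hR
  rw [MinorRatio.logInner, hlog]
  exact hneg
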